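/- Let $\mathcal C$ be a stable model category, i.e. a pointed model category for which the suspension functor $\Sigma$ is an equivalence of the homotopy category $Ho(\mathcal C)$; a cofibration $A\to B$ between cofibrant objects gives a cofiber triangle $A\to B\to B/A\to\Sigma A$ in $Ho(\mathcal C)$, and a cofiber triangle is any triangle isomorphic to one of these. Recall that $Ho(\mathcal C)$ is additive. For a chain complex $K_*=(\cdots\to K_1\to K_0)$ in $Ho(\mathcal C)$, let $F_mK_*$ be the part of $K_*$ in degrees $\le m$ (zero if $m<0$), and let $Gr^l_nFK_*=F_nK_*/F_{n-l}K_*$, the complex with the objects $K_k$, $n-l<k\le n$, and the differentials of $K_*$ between them. A totalization of $K_*$ is a sequence $T_0\to T_1\to\cdots$ in $Ho(\mathcal C)$ with maps $p_k:T_k\to\Sigma^kK_k$ such that $p_0$ is an isomorphism, and with attaching maps $a_k:\Sigma^kK_{k+1}\to T_k$ such that $p_k a_k=\Sigma^k d_{k+1}$ and $\Sigma^kK_{k+1}\xrightarrow{a_k}T_k\to T_{k+1}\xrightarrow{p_{k+1}}\Sigma^{k+1}K_{k+1}$ is a cofiber triangle for all $k\ge0$. Thus $T_k$ is filtered with subquotients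 $\Sigma^jK_j$, $j\le k$. For $K_*=Gr^l_nFC_*$ put $Tot(Gr^l_nFC_*)=T_n$, with the filtration by $T_0\to\cdots\to T_n$ (here $T_n\to T_{n+1}\to\cdots$ are isomorphisms). Let $f_\bullet:C_\bullet\to D_\bullet$ be a map of simplicial objects in $Ho(\mathcal C)$, and let $C_*$, $D_*$ be the chain complexes in $Ho(\mathcal C)$ given by the alternating sums of the face maps. Then for each $n\ge1$, and any totalizations $T^C_\bullet$ of $Gr^2_nFC_*$ and $T^D_\bullet$ of $Gr^2_nFD_*$, there is a filtration-preserving map $$h:Tot(Gr^2_nFC_*)\to Tot(Gr^2_nFD_*)$$ which agrees with $f_m$ on the subquotients $Gr^1_m=\Sigma^mC_m$ for $m=n,n-1$. More precisely, there are maps $h_k:T^C_k\to T^D_k$ for all $k\ge0$, with $h_n=h$, which commute with the transition maps $T_k\to T_{k+1}$, with the projections $p_k$ and with the attaching maps $a_k$, where $\Sigma^kGr^2_nFC_*\to\Sigma^kGr^2_nFD_*$ is given by $f_n$ and $f_{n-1}$; so $h_{k+1}$ is a map induced on the cofibers by the homotopy-commutative square formed by $a^C_k$, $a^D_k$, $h_k$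 and the $\Sigma^k$-suspension of the map $Gr^2_nFC_*\to Gr^2_nFD_*$ in degree $k+1$. If $f_m$ is a weak equivalence (i.e. an isomorphism in $Ho(\mathcal C)$) for every $m$, then $h$ can be chosen to be a weak equivalence as well. -/

import Mathlib

open CategoryTheory Limits HomotopicalAlgebra ZeroObject

namespace StableTot

section Cofibers

lemma isIso_map_of_weakEquivalence {C : Type*} [Category* C] [ModelCategory C]
    {H : Type*} [Category* H] (L : C ⥤ H) [L.IsLocalization (weakEquivalences C)]
    {X Y : C} (f : X ⟶ Y) [WeakEquivalence f] : IsIso (L.map f) :=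
  Localization.inverts L (weakEquivalences C) f ((weakEquivalence_iff f).1 inferInstance)

variable {C : Type*} [Category* C] [ModelCategory C] [HasZeroMorphisms C]

lemma weakEquivalence_cokernelMap_of_trivialCofibration {A K E : C} (i : A ⟶ K) (a : K ⟶ E)
    [Cofibration a] [WeakEquivalence a] :
    WeakEquivalence (cokernel.map i (i ≫ a) (𝟙 A) a (by simp)) := by
  have sq : IsPushout a (cokernel.π i) (cokernel.π (i ≫ a))
      (cokernel.map i (i ≫ a) (𝟙 A) a (by simp)) := by
    refine ⟨⟨by simp⟩, ⟨PushoutCocone.IsColimit.mk _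
      (fun s ↦ cokernel.desc _ s.inl ?_) ?_ ?_ ?_⟩⟩
    · rw [Category.assoc, s.condition, cokernel.condition_assoc, zero_comp]
    · intro s
      simp
    · intro s
      rw [← cancel_epi (cokernel.π i)]
      simp [s.condition]
    · intro s m hm _
      rw [← cancel_epi (cokernel.π (i ≫ a))]
      simpa using hm
  rw [weakEquivalence_iff]
  exact (MorphismProperty.of_isPushout (P := trivialCofibrations C) sq.flip
    (mem_trivialCofibrations a)).2

/-- A weak equivalence between two objects containing `A` through a cofibration induces a weak
equivalence on the quotients by `A`. -/
lemma weakEquivalence_cokernelMap_under {A K K' : C} (i : A ⟶ K) (i' : A ⟶ K')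
    [Cofibration i] [Cofibration i'] (r : K ⟶ K') [WeakEquivalence r] (w : i ≫ r = i') :
    WeakEquivalence (cokernel.map i i' (𝟙 A) r (by simp [w])) := by
  have fac := MorphismProperty.factorizationData (cofibrations C) (trivialFibrations C)
    (pushout.desc r (𝟙 K') (by simp [w]) : pushout i i' ⟶ K')
  let a : K ⟶ fac.Z := pushout.inl i i' ≫ fac.i
  let b : K' ⟶ fac.Z := pushout.inr i i' ≫ fac.i
  have : Cofibration fac.i := (cofibration_iff _).2 fac.hi
  have : WeakEquivalence fac.p := ((mem_trivialFibrations_iff _).1 fac.hp).2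
  have ha : a ≫ fac.p = r := by
    rw [Category.assoc, fac.fac]
    exact pushout.inl_desc _ _ _
  have hb : b ≫ fac.p = 𝟙 K' := by
    rw [Category.assoc, fac.fac]
    exact pushout.inr_desc _ _ _
  have : WeakEquivalence a := weakEquivalence_of_postcomp_of_fac ha
  have : WeakEquivalence b := weakEquivalence_of_postcomp_of_fac hb
  have hab : i' ≫ b = i ≫ a := by simp [a, b, pushout.condition_assoc]
  have h₁ := weakEquivalence_cokernelMap_of_trivialCofibration i a
  have h₂ := weakEquivalence_cokernelMap_of_trivialCofibration i' b
  have hp : (i' ≫ b) ≫ fac.p = i' := by rw [Category.assoc, hb, Category.comp_id]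
  have h₃ : cokernel.map i' (i' ≫ b) (𝟙 A) b (by simp) ≫
      cokernel.map (i' ≫ b) i' (𝟙 A) fac.p (by simp [hb]) = 𝟙 _ := by
    rw [← cancel_epi (cokernel.π i')]
    simp [reassoc_of% hb]
  have h₄ : WeakEquivalence (cokernel.map (i' ≫ b) i' (𝟙 A) fac.p (by simp [hb])) :=
    weakEquivalence_of_precomp_of_fac h₃
  have h₅ : cokernel.map i (i ≫ a) (𝟙 A) a (by simp) ≫
      (cokernel.map (i ≫ a) (i' ≫ b) (𝟙 A) (𝟙 _) (by simp [hab])) ≫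
      cokernel.map (i' ≫ b) i' (𝟙 A) fac.p (by simp [hb]) =
      cokernel.map i i' (𝟙 A) r (by simp [w]) := by
    rw [← cancel_epi (cokernel.π i)]
    simp [reassoc_of% ha]
  rw [← h₅]
  infer_instance

variable {H : Type*} [Category* H] (L : C ⥤ H) [L.IsLocalization (weakEquivalences C)]

variable [HasZeroObject C]

/-- Two extensions of the same map `A ⟶ A'` to a map from `K` to a fibrant contractible object
containing `A'` become equal in the homotopy category after passing to the quotients. -/
lemma map_cokernelMap_eq {A A' K K' : C} (i : A ⟶ K) (i' : A' ⟶ K') [Cofibration i]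
    [Fibration (0 : K' ⟶ 0)] [WeakEquivalence (0 : K' ⟶ 0)] (f : A ⟶ A') (g₀ g₁ : K ⟶ K')
    (h₀ : i ≫ g₀ = f ≫ i') (h₁ : i ≫ g₁ = f ≫ i') :
    L.map (cokernel.map i i' f g₀ h₀) = L.map (cokernel.map i i' f g₁ h₁) := by
  have fac := MorphismProperty.factorizationData (cofibrations C) (trivialFibrations C)
    (pushout.desc (𝟙 K) (𝟙 K) (by simp) : pushout i i ⟶ K)
  have : Cofibration fac.i := (cofibration_iff _).2 fac.hi
  have : WeakEquivalence fac.p := ((mem_trivialFibrations_iff _).1 fac.hp).2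
  let s₀ : K ⟶ fac.Z := pushout.inl i i ≫ fac.i
  let s₁ : K ⟶ fac.Z := pushout.inr i i ≫ fac.i
  have hs₀ : s₀ ≫ fac.p = 𝟙 K := by
    rw [Category.assoc, fac.fac]
    exact pushout.inl_desc _ _ _
  have hs₁ : s₁ ≫ fac.p = 𝟙 K := by
    rw [Category.assoc, fac.fac]
    exact pushout.inr_desc _ _ _
  have hs : i ≫ s₁ = i ≫ s₀ := by simp [s₀, s₁, pushout.condition_assoc]
  have sq : CommSq (pushout.desc g₀ g₁ (by rw [h₀, h₁])) fac.i (0 : K' ⟶ 0) 0 := ⟨by simp⟩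
  let G : fac.Z ⟶ K' := sq.lift
  have hG₀ : s₀ ≫ G = g₀ := by
    rw [Category.assoc, sq.fac_left]
    exact pushout.inl_desc _ _ _
  have hG₁ : s₁ ≫ G = g₁ := by
    rw [Category.assoc, sq.fac_left]
    exact pushout.inr_desc _ _ _
  have hr : (i ≫ s₀) ≫ fac.p = i := by rw [Category.assoc, hs₀, Category.comp_id]
  have : WeakEquivalence (cokernel.map (i ≫ s₀) i (𝟙 A) fac.p (by simp [hs₀])) :=
    weakEquivalence_cokernelMap_under _ _ fac.p hr
  have : IsIso (L.map (cokernel.map (i ≫ s₀) i (𝟙 A) fac.p (by simp [hs₀]))) :=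
    isIso_map_of_weakEquivalence L _
  have key : L.map (cokernel.map i (i ≫ s₀) (𝟙 A) s₀ (Category.id_comp _).symm) =
      L.map (cokernel.map i (i ≫ s₀) (𝟙 A) s₁ (by simp [hs])) := by
    rw [← cancel_mono (L.map (cokernel.map (i ≫ s₀) i (𝟙 A) fac.p (by simp [hs₀]))),
      ← L.map_comp, ← L.map_comp]
    congr 1
    rw [← cancel_epi (cokernel.π i)]
    simp [reassoc_of% hs₀, reassoc_of% hs₁]
  have e₀ : cokernel.map i i' f g₀ h₀ = cokernel.map i (i ≫ s₀) (𝟙 A) s₀ (by simp) ≫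
      cokernel.map (i ≫ s₀) i' f G (by rw [Category.assoc, hG₀, h₀]) := by
    rw [← cancel_epi (cokernel.π i)]
    simp [reassoc_of% hG₀]
  have e₁ : cokernel.map i i' f g₁ h₁ = cokernel.map i (i ≫ s₀) (𝟙 A) s₁ (by simp [hs]) ≫
      cokernel.map (i ≫ s₀) i' f G (by rw [Category.assoc, hG₀, h₀]) := by
    rw [← cancel_epi (cokernel.π i)]
    simp [reassoc_of% hG₁]
  rw [e₀, e₁, L.map_comp, L.map_comp, key]

end Cofibers

section Suspension

variable {C : Type*} [Category* C] [ModelCategory C] [HasZeroMorphisms C] [HasZeroObject C]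

/-- A cone on `A`: a cofibration from `A` to a weakly contractible object. -/
structure ConeOn (A : C) where
  /-- the underlying object -/
  obj : C
  /-- the inclusion of the base of the cone -/
  ι : A ⟶ obj
  cofibration_ι : Cofibration ι
  weakEquivalence_zero : WeakEquivalence (0 : obj ⟶ 0)

attribute [instance] ConeOn.cofibration_ι ConeOn.weakEquivalence_zero

/-- A cone on `A` which is moreover fibrant. -/
structure FibrantConeOn (A : C) extends ConeOn A where
  fibration_zero : Fibration (0 : obj ⟶ 0)

attribute [instance] FibrantConeOn.fibration_zero

instance (A : C) : Nonempty (FibrantConeOn A) := by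
  have fac := MorphismProperty.factorizationData (cofibrations C) (trivialFibrations C)
    (0 : A ⟶ 0)
  have hp : fac.p = 0 := (isZero_zero C).eq_of_tgt _ _
  have := (mem_trivialFibrations_iff _).1 fac.hp
  rw [hp] at this
  exact ⟨{ obj := fac.Z
           ι := fac.i
           cofibration_ι := (cofibration_iff _).2 fac.hi
           weakEquivalence_zero := this.2
           fibration_zero := this.1 }⟩

/-- A chosen fibrant cone on `A`. -/
noncomputable def stdCone (A : C) : FibrantConeOn A := Classical.arbitrary _

/-- The extension of a map `A ⟶ A'` to a map of cones. -/
lemma ConeOn.exists_map {A A' : C} (K : ConeOn A) (K' : FibrantConeOn A') (f : A ⟶ A') :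
    ∃ g : K.obj ⟶ K'.obj, K.ι ≫ g = f ≫ K'.ι := by
  have sq : CommSq (f ≫ K'.ι) K.ι (0 : K'.obj ⟶ 0) 0 := ⟨by simp⟩
  exact ⟨sq.lift, sq.fac_left⟩

/-- A chosen extension of a map `A ⟶ A'` to a map of cones. -/
noncomputable def ConeOn.map {A A' : C} (K : ConeOn A) (K' : FibrantConeOn A') (f : A ⟶ A') :
    K.obj ⟶ K'.obj := (K.exists_map K' f).choose

lemma ConeOn.ι_map {A A' : C} (K : ConeOn A) (K' : FibrantConeOn A') (f : A ⟶ A') :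
    K.ι ≫ K.map K' f = f ≫ K'.ι := (K.exists_map K' f).choose_spec

lemma ConeOn.weakEquivalence_of_map {A A' : C} (K : ConeOn A) (K' : ConeOn A')
    (g : K.obj ⟶ K'.obj) : WeakEquivalence g :=
  weakEquivalence_of_postcomp_of_fac (show g ≫ (0 : K'.obj ⟶ 0) = 0 by simp)

/-- The quotient `K / A` of a cone `K` on `A`: a model of the suspension of `A`. -/
noncomputable abbrev ConeOn.quot {A : C} (K : ConeOn A) : C := cokernel K.ι

/-- The map induced on quotients by a map of cones. -/
noncomputable def ConeOn.quotMap {A A' : C} (K : ConeOn A) (K' : FibrantConeOn A')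
    (f : A ⟶ A') : K.quot ⟶ K'.quot :=
  cokernel.map K.ι K'.ι f (K.map K' f) (K.ι_map K' f)

variable {H : Type*} [Category* H] (L : C ⥤ H) [L.IsLocalization (weakEquivalences C)]

lemma ConeOn.map_quotMap_eq {A A' : C} (K : ConeOn A) (K' : FibrantConeOn A') (f : A ⟶ A')
    (g : K.obj ⟶ K'.obj) (hg : K.ι ≫ g = f ≫ K'.ι) :
    L.map (K.quotMap K' f) = L.map (cokernel.map K.ι K'.ι f g hg) :=
  map_cokernelMap_eq L K.ι K'.ι f _ _ (K.ι_map K' f) hg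

lemma ConeOn.map_quotMap_comp {A A' A'' : C} (K : ConeOn A) (K' : FibrantConeOn A')
    (K'' : FibrantConeOn A'') (f : A ⟶ A') (f' : A' ⟶ A'') :
    L.map (K.quotMap K'' (f ≫ f')) =
      L.map (K.quotMap K' f) ≫ L.map (K'.quotMap K'' f') := by
  rw [← L.map_comp, K.map_quotMap_eq L K'' (f ≫ f') (K.map K' f ≫ K'.map K'' f')
    (by rw [reassoc_of% (K.ι_map K' f), ConeOn.ι_map, Category.assoc])]
  congr 1
  rw [← cancel_epi (cokernel.π K.ι)]
  simp [quotMap]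

lemma ConeOn.map_quotMap_id {A : C} (K : FibrantConeOn A) :
    L.map (K.quotMap K (𝟙 A)) = 𝟙 _ := by
  rw [ConeOn.map_quotMap_eq L _ K (𝟙 A) (𝟙 _) (by simp), ← L.map_id]
  congr 1
  rw [← cancel_epi (cokernel.π K.ι)]
  simp

instance ConeOn.isIso_map_quotMap {A : C} (K : ConeOn A) (K' : FibrantConeOn A) :
    IsIso (L.map (K.quotMap K' (𝟙 A))) := by
  have := K.weakEquivalence_of_map K'.toConeOn (K.map K' (𝟙 A))
  have : WeakEquivalence (K.quotMap K' (𝟙 A)) :=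
    weakEquivalence_cokernelMap_under _ _ _ (by simp [K.ι_map])
  exact isIso_map_of_weakEquivalence L _

lemma ConeOn.isIso_map_quotMap_of_trivialCofibration {A A' : C} (K : ConeOn A)
    (K' : FibrantConeOn A') (f : A ⟶ A') [Cofibration f] [WeakEquivalence f] :
    IsIso (L.map (K.quotMap K' f)) := by
  -- push the cone `K` out along `f`
  have : WeakEquivalence (0 : pushout K.ι f ⟶ 0) :=
    weakEquivalence_of_precomp_of_fac (show pushout.inl K.ι f ≫ 0 = (0 : K.obj ⟶ 0) by simp)
  let P : ConeOn A' :=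
    { obj := pushout K.ι f
      ι := pushout.inr _ _
      cofibration_ι := inferInstance
      weakEquivalence_zero := this }
  have : IsIso (cokernel.map K.ι (pushout.inr K.ι f) f (pushout.inl K.ι f)
      pushout.condition) :=
    isIso_cokernel_map_of_isPushout (IsPushout.of_hasPushout K.ι f)
  have e : L.map (K.quotMap K' f) = L.map (cokernel.map K.ι (pushout.inr K.ι f) f
      (pushout.inl K.ι f) pushout.condition) ≫ L.map (P.quotMap K' (𝟙 A')) := by
    rw [← L.map_comp, K.map_quotMap_eq L K' f (pushout.inl K.ι f ≫ P.map K' (𝟙 A')) (by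
      have := P.ι_map K' (𝟙 A')
      rw [Category.id_comp] at this
      rw [pushout.condition_assoc, ← this])]
    congr 1
    rw [← cancel_epi (cokernel.π K.ι)]
    simp [quotMap, P]
  rw [e]
  infer_instance

/-- The functor sending a cofibrant object `A` to the quotient of its chosen cone by `A`. -/
noncomputable def cofibrantSuspension : CofibrantObject C ⥤ H where
  obj A := L.obj (stdCone A.obj).quot
  map {A A'} f := L.map ((stdCone A.obj).quotMap (stdCone A'.obj) f.hom)
  map_id _ := ConeOn.map_quotMap_id L _
  map_comp f g := ConeOn.map_quotMap_comp L _ _ _ f.hom g.hom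

lemma cofibrantSuspension_inverts :
    (weakEquivalences (CofibrantObject C)).IsInvertedBy (cofibrantSuspension L) := by
  have h {A A' : CofibrantObject C} (f : A ⟶ A') (_ : Cofibration f.hom)
      (_ : WeakEquivalence f.hom) : IsIso ((cofibrantSuspension L).map f) :=
    ConeOn.isIso_map_quotMap_of_trivialCofibration L _ _ _
  intro A A' f hf
  have hf' : WeakEquivalence f.hom := (weakEquivalence_iff _).2 hf
  obtain ⟨b⟩ := (inferInstance : Nonempty (CofibrantBrownFactorization f.hom))
  have : Cofibration b.i := (cofibration_iff _).2 b.hi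
  have : IsCofibrant b.Z := isCofibrant_of_cofibration b.i
  let i : A ⟶ CofibrantObject.mk b.Z := ObjectProperty.homMk b.i
  let p : CofibrantObject.mk b.Z ⟶ A' := ObjectProperty.homMk b.p
  let s : A' ⟶ CofibrantObject.mk b.Z := ObjectProperty.homMk b.s
  have hi : IsIso ((cofibrantSuspension L).map i) := h i ‹_› (inferInstanceAs (WeakEquivalence b.i))
  have hs : IsIso ((cofibrantSuspension L).map s) :=
    h s (inferInstanceAs (Cofibration b.s)) (inferInstanceAs (WeakEquivalence b.s))
  have hsp : (cofibrantSuspension L).map s ≫ (cofibrantSuspension L).map p = 𝟙 _ := by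
    rw [← Functor.map_comp, ← (cofibrantSuspension L).map_id]
    congr 1
    ext
    exact b.s_p
  have hp : IsIso ((cofibrantSuspension L).map p) := IsIso.of_isIso_fac_left hsp
  have hip : i ≫ p = f := by
    ext
    exact b.fac
  rw [← hip, Functor.map_comp]
  infer_instance

/-- The suspension functor on the homotopy category: it sends the class of a cofibrant object `A`
to the class of `K / A`, where `K` is any cone on `A` (see `suspensionIso`). -/
noncomputable def suspension : H ⥤ H :=
  Localization.lift (cofibrantSuspension L) (cofibrantSuspension_inverts L)
    (CofibrantObject.ι ⋙ L)

/-- The suspension of a cofibrant object `A` in terms of the chosen cone on `A`. -/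
noncomputable def suspensionStdIso (A : C) [IsCofibrant A] :
    L.obj (stdCone A).quot ≅ (suspension L).obj (L.obj A) :=
  (Localization.fac (cofibrantSuspension L) (cofibrantSuspension_inverts L)
    (CofibrantObject.ι ⋙ L)).symm.app (CofibrantObject.mk A)

lemma suspensionStdIso_naturality {A A' : C} [IsCofibrant A] [IsCofibrant A'] (f : A ⟶ A') :
    L.map ((stdCone A).quotMap (stdCone A') f) ≫ (suspensionStdIso L A').hom =
      (suspensionStdIso L A).hom ≫ (suspension L).map (L.map f) :=
  (Localization.fac (cofibrantSuspension L) (cofibrantSuspension_inverts L)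
    (CofibrantObject.ι ⋙ L)).inv.naturality (CofibrantObject.homMk f)

/-- For every cone `K` on a cofibrant object `A`, the quotient `K / A` represents the suspension
of `A`. -/
noncomputable def suspensionIso {A : C} [IsCofibrant A] (K : ConeOn A) :
    L.obj K.quot ≅ (suspension L).obj (L.obj A) :=
  asIso (L.map (K.quotMap (stdCone A) (𝟙 A))) ≪≫ suspensionStdIso L A

/-- The isomorphisms `suspensionIso` are natural with respect to all maps of cones. -/
lemma suspensionIso_naturality {A A' : C} [IsCofibrant A] [IsCofibrant A'] (K : ConeOn A)
    (K' : ConeOn A') (f : A ⟶ A') (g : K.obj ⟶ K'.obj) (w : K.ι ≫ g = f ≫ K'.ι) :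
    L.map (cokernel.map K.ι K'.ι f g w) ≫ (suspensionIso L K').hom =
      (suspensionIso L K).hom ≫ (suspension L).map (L.map f) := by
  have h₁ : L.map (cokernel.map K.ι K'.ι f g w) ≫ L.map (K'.quotMap (stdCone A') (𝟙 A')) =
      L.map (K.quotMap (stdCone A') f) := by
    rw [← L.map_comp, K.map_quotMap_eq L (stdCone A') f (g ≫ K'.map (stdCone A') (𝟙 A')) (by
      rw [reassoc_of% w, K'.ι_map, Category.id_comp])]
    congr 1
    rw [← cancel_epi (cokernel.π K.ι)]
    simp [ConeOn.quotMap]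
  have h₂ := K.map_quotMap_comp L (stdCone A) (stdCone A') (𝟙 A) f
  rw [Category.id_comp] at h₂
  simp only [suspensionIso, Iso.trans_hom, asIso_hom, Category.assoc]
  rw [reassoc_of% h₁, h₂, Category.assoc, suspensionStdIso_naturality]

end Suspension

section CofiberTriangles

variable {C : Type*} [Category* C] [ModelCategory C] [HasZeroMorphisms C] [HasZeroObject C]

/-- The map `B ∪_A K ⟶ B / A` collapsing a cone `K` on `A` attached to `B` along `i : A ⟶ B`. -/
noncomputable def collapseCone {A B : C} (i : A ⟶ B) (K : ConeOn A) :
    pushout i K.ι ⟶ cokernel i :=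
  pushout.desc (cokernel.π i) 0 (by simp)

/-- The map `B ∪_A K ⟶ K / A` collapsing `B`. -/
noncomputable def collapseBase {A B : C} (i : A ⟶ B) (K : ConeOn A) :
    pushout i K.ι ⟶ K.quot :=
  pushout.desc 0 (cokernel.π K.ι) (by simp)

variable {H : Type*} [Category* H] (L : C ⥤ H) [L.IsLocalization (weakEquivalences C)]

/-- `X ⟶ Y ⟶ Z ⟶ ΣX` is a cofiber triangle in the homotopy category if it is isomorphic to the
triangle `A ⟶ B ⟶ B / A ⟶ ΣA` of some cofibration `i : A ⟶ B` with `A` cofibrant. The last map of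
the latter is the composition of the inverse of `B ∪_A K ⟶ B / A`, which is a weak equivalence,
with `B ∪_A K ⟶ K / A` and `K / A ≅ ΣA`, for a cone `K` on `A`. -/
def IsCofiberTriangle {X Y Z : H} (u : X ⟶ Y) (v : Y ⟶ Z) (w : Z ⟶ (suspension L).obj X) : Prop :=
  ∃ (A B : C) (_ : IsCofibrant A) (i : A ⟶ B) (_ : Cofibration i) (K : ConeOn A)
    (eX : L.obj A ≅ X) (eY : L.obj B ≅ Y) (eZ : L.obj (cokernel i) ≅ Z),
    L.map i ≫ eY.hom = eX.hom ≫ u ∧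
    L.map (cokernel.π i) ≫ eZ.hom = eY.hom ≫ v ∧
    L.map (collapseCone i K) ≫ eZ.hom ≫ w =
      L.map (collapseBase i K) ≫ (suspensionIso L K).hom ≫ (suspension L).map eX.hom

/-- The iterated suspension `Σ^k`. -/
noncomputable def iteratedSuspension : ℕ → (H ⥤ H)
  | 0 => 𝟭 H
  | k + 1 => iteratedSuspension k ⋙ suspension L

end CofiberTriangles

section Complexes

variable {H : Type*} [Category* H] [Preadditive H] [HasZeroObject H]

/-- The objects of `Gr^l_n K`: they are those of `K` in the degrees `k` with `n - l < k ≤ n`. -/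
noncomputable def grX (l n : ℕ) (K : ChainComplex H ℕ) (k : ℕ) : H :=
  if k ≤ n ∧ n < k + l then K.X k else 0

/-- The identification of `Gr^l_n K` with `K` in the degrees `k` with `n - l < k ≤ n`. -/
noncomputable def grXIso {l n : ℕ} (K : ChainComplex H ℕ) {k : ℕ} (h : k ≤ n ∧ n < k + l) :
    grX l n K k ≅ K.X k :=
  eqToIso (if_pos h)

lemma isZero_grX {l n : ℕ} (K : ChainComplex H ℕ) {k : ℕ} (h : ¬ (k ≤ n ∧ n < k + l)) :
    IsZero (grX l n K k) := by
  rw [grX, if_neg h]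
  exact isZero_zero H

/-- The differential of `Gr^l_n K`. -/
noncomputable def grD (l n : ℕ) (K : ChainComplex H ℕ) (i j : ℕ) : grX l n K i ⟶ grX l n K j :=
  if h : (i ≤ n ∧ n < i + l) ∧ (j ≤ n ∧ n < j + l) then
    (grXIso K h.1).hom ≫ K.d i j ≫ (grXIso K h.2).inv else 0

/-- The subquotient `Gr^l_n K = F_n K / F_{n-l} K` of the skeletal filtration of a chain complex
`K`, where `F_n K` is the part of `K` in degrees `≤ n` (so that `F_m K = 0` for `m < 0`). It is the
part of `K` in the degrees `k` with `n - l < k ≤ n`. -/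
noncomputable def gr (l n : ℕ) (K : ChainComplex H ℕ) : ChainComplex H ℕ where
  X := grX l n K
  d := grD l n K
  shape i j hij := by
    rw [grD]
    split_ifs with h
    · rw [K.shape i j hij, zero_comp, comp_zero]
    · rfl
  d_comp_d' i j k _ _ := by
    rw [grD, grD]
    split_ifs <;> simp

/-- The components of the map induced on `Gr^l_n` by a map of chain complexes. -/
noncomputable def grMapF (l n : ℕ) {K K' : ChainComplex H ℕ} (φ : K ⟶ K') (k : ℕ) :
    grX l n K k ⟶ grX l n K' k :=
  if h : k ≤ n ∧ n < k + l then (grXIso K h).hom ≫ φ.f k ≫ (grXIso K' h).inv else 0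

/-- The map induced on `Gr^l_n` by a map of chain complexes. -/
noncomputable def grMap (l n : ℕ) {K K' : ChainComplex H ℕ} (φ : K ⟶ K') :
    gr l n K ⟶ gr l n K' where
  f := grMapF l n φ
  comm' i j _ := by
    change grMapF l n φ i ≫ grD l n K' i j = grD l n K i j ≫ grMapF l n φ j
    by_cases hi : i ≤ n ∧ n < i + l <;> by_cases hj : j ≤ n ∧ n < j + l <;>
      simp [grMapF, grD, hi, hj]

end Complexes

section Totalization

variable {C : Type*} [Category* C] [ModelCategory C] [HasZeroMorphisms C] [HasZeroObject C]
  {H : Type*} [Category* H] [Preadditive H]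
  (L : C ⥤ H) [L.IsLocalization (weakEquivalences C)]

/-- A totalization of a chain complex `K` in the homotopy category: a sequence of objects
`T 0 ⟶ T 1 ⟶ ⋯` (`T k` being a total object of `K_k ⟶ ⋯ ⟶ K_0`) which starts with `T 0 ≅ K_0`, and
such that `T (k + 1)` is the cofiber of a map `Σ^k K_{k+1} ⟶ T k` which lifts
`Σ^k d : Σ^k K_{k+1} ⟶ Σ^k K_k`. In particular the subquotients of this filtration are the
`Σ^k K_k`. -/
structure Totalization (K : ChainComplex H ℕ) where
  /-- the filtration -/
  T : ℕ → H
  /-- the transition maps of the filtration -/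
  incl (k : ℕ) : T k ⟶ T (k + 1)
  /-- the projection to the `k`-th subquotient -/
  proj (k : ℕ) : T k ⟶ (iteratedSuspension L k).obj (K.X k)
  /-- the attaching maps -/
  att (k : ℕ) : (iteratedSuspension L k).obj (K.X (k + 1)) ⟶ T k
  isIso_proj_zero : IsIso (proj 0)
  att_proj (k : ℕ) : att k ≫ proj k = (iteratedSuspension L k).map (K.d (k + 1) k)
  isCofiberTriangle (k : ℕ) : IsCofiberTriangle L (att k) (incl k) (proj (k + 1))

variable {L}

/-- A filtration-preserving map between totalizations of chain complexes `K` and `K'`, which is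
given by a chain map `φ` on the subquotients: each step of the filtration is mapped by the map
induced on the cofibers by the commutative square of attaching maps. -/
structure FilteredMap {K K' : ChainComplex H ℕ} (S : Totalization L K) (T : Totalization L K')
    (φ : K ⟶ K') where
  /-- the map on the `k`-th step of the filtration -/
  app (k : ℕ) : S.T k ⟶ T.T k
  incl_app (k : ℕ) : S.incl k ≫ app (k + 1) = app k ≫ T.incl k
  proj_map (k : ℕ) : S.proj k ≫ (iteratedSuspension L k).map (φ.f k) = app k ≫ T.proj k
  att_app (k : ℕ) : S.att k ≫ app k = (iteratedSuspension L k).map (φ.f (k + 1)) ≫ T.att k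

variable [HasZeroObject H]

/-- The underlying object `Tot (Gr^l_n K)` of a totalization of `Gr^l_n K`: it is the `n`-th step of
the filtration, as `Gr^l_n K` vanishes in degrees `> n`. -/
def Totalization.tot {l n : ℕ} {K : ChainComplex H ℕ} (S : Totalization L (gr l n K)) : H :=
  S.T n

/-- The underlying map `Tot (Gr^l_n K) ⟶ Tot (Gr^l_n K')` of a filtration-preserving map. -/
def FilteredMap.tot {l n : ℕ} {K K' : ChainComplex H ℕ} {S : Totalization L (gr l n K)}
    {T : Totalization L (gr l n K')} {φ : gr l n K ⟶ gr l n K'} (h : FilteredMap S T φ) :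
    S.tot ⟶ T.tot :=
  h.app n

end Totalization

end StableTot

open AlgebraicTopology StableTot

/-!
A localization functor at the weak equivalences of a model category inverts nothing else, and a
square in the homotopy category whose first leg is a cofibration becomes strictly commutative once
its targets are fibrant. So a commutative square between the first maps of two cofiber triangles
comes from an actual map of cofibrations, which induces a fill-in on the cofibers; if the square is
invertible, the gluing lemma makes the fill-in invertible.

A filtered map of totalizations is a sequence of such fill-ins. Each of them respects the
projections, but the next one also needs compatibility with the attaching maps. In `Gr²` this is
automatic: there are no objects below degree `n - 1`, so the projections `p_k`, `k < n`, are
isomorphisms and `p_k a_k = Σ^k d` determines `a_k`; from degree `n` on, the sources of the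
attaching maps vanish.
-/

namespace StableTot

attribute [local instance] isIso_map_of_weakEquivalence

section Rectification

variable {C : Type*} [Category* C] [ModelCategory C]
  {H : Type*} [Category* H] (L : C ⥤ H) [L.IsLocalization (weakEquivalences C)]

lemma exists_lift_of_map_fac {X Y Z : C} [IsCofibrant Z] [IsFibrant Y]
    (p : X ⟶ Y) [Fibration p] (g : Z ⟶ Y) (σ : L.obj Z ⟶ L.obj X)
    (hσ : σ ≫ L.map p = L.map g) : ∃ s : Z ⟶ X, s ≫ p = g ∧ L.map s = σ := by
  have := isFibrant_of_fibration p
  obtain ⟨s₀, rfl⟩ := map_surjective_of_isLocalization L Z X σ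
  rw [← L.map_comp, ← LeftHomotopyRel.iff_map_eq L] at hσ
  obtain ⟨P, _, ⟨h⟩⟩ := hσ.exists_good_cylinder
  obtain ⟨s, h', hh⟩ := h.covering_homotopy p s₀
  exact ⟨s, by rw [← h'.h₁, Category.assoc, hh, h.h₁],
    ((LeftHomotopyRel.iff_map_eq L _ _).1 h'.leftHomotopyRel).symm⟩

lemma exists_extension_of_map_fac {A B X : C} [IsCofibrant A] [IsFibrant X]
    (i : A ⟶ B) [Cofibration i] (f : A ⟶ X) (β : L.obj B ⟶ L.obj X)
    (hβ : L.map i ≫ β = L.map f) : ∃ g : B ⟶ X, i ≫ g = f ∧ L.map g = β := by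
  have := isCofibrant_of_cofibration i
  obtain ⟨g₀, rfl⟩ := map_surjective_of_isLocalization L B X β
  rw [← L.map_comp, ← RightHomotopyRel.iff_map_eq L] at hβ
  obtain ⟨P, _, ⟨h⟩⟩ := hβ.exists_good_pathObject
  obtain ⟨g, h', hh⟩ := h.homotopy_extension i g₀
  exact ⟨g, by rw [← h'.h₁, reassoc_of% hh, h.h₁],
    ((RightHomotopyRel.iff_map_eq L _ _).1 h'.rightHomotopyRel).symm⟩

lemma exists_strict_square {A B A' B' : C} [IsCofibrant A] [IsFibrant A'] [IsFibrant B']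
    (i : A ⟶ B) [Cofibration i] (i' : A' ⟶ B') (α : L.obj A ⟶ L.obj A')
    (β : L.obj B ⟶ L.obj B') (w : L.map i ≫ β = α ≫ L.map i') :
    ∃ (f : A ⟶ A') (g : B ⟶ B'), i ≫ g = f ≫ i' ∧ L.map f = α ∧ L.map g = β := by
  obtain ⟨f, rfl⟩ := map_surjective_of_isLocalization L A A' α
  obtain ⟨g, hg, rfl⟩ := exists_extension_of_map_fac L i (f ≫ i') β (by rw [w, L.map_comp])
  exact ⟨f, g, hg, rfl, rfl⟩

lemma weakEquivalence_of_fibration_of_isIso_map {X Y : C} [IsCofibrant X] [IsCofibrant Y]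
    [IsFibrant Y] (p : X ⟶ Y) [Fibration p] [IsIso (L.map p)] :
    WeakEquivalence p := by
  have := isFibrant_of_fibration p
  obtain ⟨s, hs, hLs⟩ := exists_lift_of_map_fac L p (𝟙 Y) (inv (L.map p)) (by simp)
  have hps : RightHomotopyRel (p ≫ s) (𝟙 X) := by
    rw [RightHomotopyRel.iff_map_eq L, L.map_comp, hLs, IsIso.hom_inv_id, L.map_id]
  obtain ⟨Q, ⟨h⟩⟩ := hps
  have hw : WeakEquivalence (p ≫ s) := h.weakEquivalence_iff.2 inferInstance
  let r : RetractArrow p (p ≫ s) :=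
    { i := Arrow.homMk (𝟙 X) s
      r := Arrow.homMk (𝟙 X) p (by simp [hs])
      retract := by ext <;> simp [hs] }
  rw [weakEquivalence_iff] at hw ⊢
  exact (weakEquivalences C).of_retract r hw

lemma weakEquivalence_of_isIso_map_of_isFibrant {X Y : C} [IsCofibrant X] [IsCofibrant Y]
    [IsFibrant Y] (f : X ⟶ Y) [IsIso (L.map f)] : WeakEquivalence f := by
  have fac := MorphismProperty.factorizationData (trivialCofibrations C) (fibrations C) f
  obtain ⟨_, _⟩ := (mem_trivialCofibrations_iff _).1 fac.hi
  have : Fibration fac.p := (fibration_iff _).2 fac.hp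
  have := isCofibrant_of_cofibration fac.i
  have : IsIso (L.map fac.p) :=
    IsIso.of_isIso_fac_left (show L.map fac.i ≫ L.map fac.p = L.map f by
      rw [← L.map_comp, fac.fac])
  have := weakEquivalence_of_fibration_of_isIso_map L fac.p
  rw [← fac.fac]
  infer_instance

open CofibrantObject.HoCat in
lemma weakEquivalence_of_isIso_map {X Y : C} (f : X ⟶ Y) [IsIso (L.map f)] :
    WeakEquivalence f := by
  have fac : L.map (resolutionMap f) ≫ L.map (pResolutionObj Y) =
      L.map (pResolutionObj X) ≫ L.map f := by
    rw [← L.map_comp, resolutionMap_fac, L.map_comp]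
  have : IsIso (L.map (resolutionMap f)) := IsIso.of_isIso_fac_right fac
  let j := FibrantObject.HoCat.iResolutionObj (resolutionObj Y)
  have : IsIso (L.map (resolutionMap f ≫ j)) := by
    rw [L.map_comp]
    infer_instance
  have := weakEquivalence_of_isIso_map_of_isFibrant L (resolutionMap f ≫ j)
  rwa [weakEquivalence_postcomp_iff, weakEquivalence_resolutionMap_iff] at this

lemma exists_bifibrant_cofibration {A B : C} [IsCofibrant A] (i : A ⟶ B) [Cofibration i] :
    ∃ (A' B' : C) (_ : IsCofibrant A') (_ : IsFibrant A') (_ : IsFibrant B') (i' : A' ⟶ B')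
      (_ : Cofibration i') (a : A ⟶ A') (b : B ⟶ B') (_ : WeakEquivalence a)
      (_ : WeakEquivalence b), i ≫ b = a ≫ i' := by
  let a := FibrantObject.HoCat.iResolutionObj A
  let b := FibrantObject.HoCat.iResolutionObj (pushout i a)
  refine ⟨_, _, inferInstance, inferInstance, inferInstance, pushout.inr i a ≫ b, inferInstance,
    a, pushout.inl i a ≫ b, inferInstance, inferInstance, ?_⟩
  rw [pushout.condition_assoc]

lemma isCofibrant_of_isZero {Z : C} (hZ : IsZero Z) : IsCofibrant Z :=
  (isCofibrant_iff_of_isInitial (𝟙 Z) hZ.isInitial).2 inferInstance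

lemma isFibrant_of_isZero {Z : C} (hZ : IsZero Z) : IsFibrant Z :=
  (isFibrant_iff_of_isTerminal (𝟙 Z) hZ.isTerminal).2 inferInstance

lemma isZero_map_of_isZero [HasZeroMorphisms H] {Z : C} (hZ : IsZero Z) : IsZero (L.obj Z) := by
  have := isCofibrant_of_isZero hZ
  have := isFibrant_of_isZero hZ
  obtain ⟨f, hf⟩ := map_surjective_of_isLocalization L Z Z 0
  rw [IsZero.iff_id_eq_zero, ← hf, ← L.map_id, hZ.eq_of_src (𝟙 Z) f]

end Rectification

section Gluing

variable {C : Type*} [Category* C] [ModelCategory C] [HasZeroMorphisms C]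

lemma weakEquivalence_cokernelMap_of_trivialCofibration_left {A B A' B' : C}
    (i : A ⟶ B) (i' : A' ⟶ B') [Cofibration i] [Cofibration i'] (f : A ⟶ A') (g : B ⟶ B')
    (w : i ≫ g = f ≫ i') [Cofibration f] [WeakEquivalence f] [WeakEquivalence g] :
    WeakEquivalence (cokernel.map i i' f g w) := by
  let q : pushout i f ⟶ B' := pushout.desc g i' w
  have hq : pushout.inl i f ≫ q = g := pushout.inl_desc _ _ _
  have hq' : pushout.inr i f ≫ q = i' := pushout.inr_desc _ _ _
  have : WeakEquivalence q := weakEquivalence_of_precomp_of_fac hq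
  have : IsIso (cokernel.map i (pushout.inr i f) f (pushout.inl i f) pushout.condition) :=
    isIso_cokernel_map_of_isPushout (IsPushout.of_hasPushout i f)
  have := weakEquivalence_cokernelMap_under (pushout.inr i f) i' q hq'
  have fac : cokernel.map i (pushout.inr i f) f (pushout.inl i f) pushout.condition ≫
      cokernel.map (pushout.inr i f) i' (𝟙 A') q (by simp [hq']) = cokernel.map i i' f g w := by
    ext
    simp [reassoc_of% hq]
  rw [← fac]
  infer_instance

lemma weakEquivalence_cokernelMap_of_retraction {A B A' B' : C}
    (i : A ⟶ B) (i' : A' ⟶ B') [Cofibration i] [Cofibration i'] (p : A ⟶ A') (g : B ⟶ B')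
    (w : i ≫ g = p ≫ i') [WeakEquivalence g] (s : A' ⟶ A) [Cofibration s] [WeakEquivalence s]
    (hs : s ≫ p = 𝟙 A') : WeakEquivalence (cokernel.map i i' p g w) := by
  have hsi : (s ≫ i) ≫ g = i' := by rw [Category.assoc, w, reassoc_of% hs]
  have := weakEquivalence_cokernelMap_under (s ≫ i) i' g hsi
  have := weakEquivalence_cokernelMap_of_trivialCofibration_left (s ≫ i) i s (𝟙 B) (by simp)
  have fac : cokernel.map (s ≫ i) i s (𝟙 B) (by simp) ≫ cokernel.map i i' p g w =
      cokernel.map (s ≫ i) i' (𝟙 A') g (by simp [hsi]) := by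
    ext
    simp
  exact weakEquivalence_of_precomp_of_fac fac

lemma weakEquivalence_cokernelMap {A B A' B' : C} [IsCofibrant A] [IsCofibrant A']
    (i : A ⟶ B) (i' : A' ⟶ B') [Cofibration i] [Cofibration i'] (f : A ⟶ A') (g : B ⟶ B')
    (w : i ≫ g = f ≫ i') [WeakEquivalence f] [WeakEquivalence g] :
    WeakEquivalence (cokernel.map i i' f g w) := by
  let b : CofibrantBrownFactorization f := Classical.arbitrary _
  have : Cofibration b.i := (cofibration_iff _).2 b.hi
  let q : pushout i b.i ⟶ B' := pushout.desc g (b.p ≫ i') (by rw [w, b.fac_assoc])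
  have hq : pushout.inl i b.i ≫ q = g := pushout.inl_desc _ _ _
  have hq' : pushout.inr i b.i ≫ q = b.p ≫ i' := pushout.inr_desc _ _ _
  have : WeakEquivalence q := weakEquivalence_of_precomp_of_fac hq
  have : IsIso (cokernel.map i (pushout.inr i b.i) b.i (pushout.inl i b.i) pushout.condition) :=
    isIso_cokernel_map_of_isPushout (IsPushout.of_hasPushout i b.i)
  have := weakEquivalence_cokernelMap_of_retraction (pushout.inr i b.i) i' b.p q hq' b.s b.s_p
  have fac : cokernel.map i (pushout.inr i b.i) b.i (pushout.inl i b.i) pushout.condition ≫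
      cokernel.map (pushout.inr i b.i) i' b.p q hq' = cokernel.map i i' f g w := by
    ext
    simp [reassoc_of% hq]
  rw [← fac]
  infer_instance

variable [HasZeroObject C]

lemma weakEquivalence_cokernelπ {A B : C} [IsCofibrant A] (i : A ⟶ B) [Cofibration i]
    [WeakEquivalence (0 : A ⟶ 0)] : WeakEquivalence (cokernel.π i) := by
  have cofibration_zero (X : C) [IsCofibrant X] : Cofibration (0 : (0 : C) ⟶ X) :=
    (isCofibrant_iff_of_isInitial _ (isZero_zero C).isInitial).1 inferInstance
  have := isCofibrant_of_cofibration i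
  have := cofibration_zero A
  have := cofibration_zero B
  have : WeakEquivalence (0 : 0 ⟶ A) :=
    weakEquivalence_of_postcomp_of_fac
      (show (0 : 0 ⟶ A) ≫ (0 : A ⟶ 0) = 𝟙 0 from (isZero_zero C).eq_of_src _ _)
  have := weakEquivalence_cokernelMap_of_trivialCofibration_left (0 : (0 : C) ⟶ B) i 0 (𝟙 B)
    (by simp)
  have fac : cokernel.π (0 : (0 : C) ⟶ B) ≫
      cokernel.map (0 : (0 : C) ⟶ B) i 0 (𝟙 B) (by simp) = cokernel.π i := by simp
  rw [← fac]
  infer_instance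

end Gluing

section Connecting

variable {C : Type*} [Category* C] [ModelCategory C] [HasZeroMorphisms C] [HasZeroObject C]

lemma inl_collapseCone {A B : C} (i : A ⟶ B) (K : ConeOn A) :
    pushout.inl i K.ι ≫ collapseCone i K = cokernel.π i := pushout.inl_desc _ _ _

lemma inr_collapseCone {A B : C} (i : A ⟶ B) (K : ConeOn A) :
    pushout.inr i K.ι ≫ collapseCone i K = 0 := pushout.inr_desc _ _ _

lemma inl_collapseBase {A B : C} (i : A ⟶ B) (K : ConeOn A) :
    pushout.inl i K.ι ≫ collapseBase i K = 0 := pushout.inl_desc _ _ _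

lemma inr_collapseBase {A B : C} (i : A ⟶ B) (K : ConeOn A) :
    pushout.inr i K.ι ≫ collapseBase i K = cokernel.π K.ι := pushout.inr_desc _ _ _

instance weakEquivalence_collapseCone {A B : C} [IsCofibrant A] (i : A ⟶ B) [Cofibration i]
    (K : ConeOn A) : WeakEquivalence (collapseCone i K) := by
  have := isCofibrant_of_cofibration K.ι
  have : IsIso (cokernel.map i (pushout.inr i K.ι) K.ι (pushout.inl i K.ι) pushout.condition) :=
    isIso_cokernel_map_of_isPushout (IsPushout.of_hasPushout i K.ι)
  have := weakEquivalence_cokernelπ (pushout.inr i K.ι)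
  have fac : collapseCone i K ≫
      cokernel.map i (pushout.inr i K.ι) K.ι (pushout.inl i K.ι) pushout.condition =
      cokernel.π (pushout.inr i K.ι) := by
    ext
    · simp [reassoc_of% inl_collapseCone i K]
    · simp [reassoc_of% inr_collapseCone i K]
  exact weakEquivalence_of_postcomp_of_fac fac

instance weakEquivalence_collapseBase {A B : C} [IsCofibrant A] (i : A ⟶ B) [Cofibration i]
    [WeakEquivalence (0 : B ⟶ 0)] (K : ConeOn A) : WeakEquivalence (collapseBase i K) := by
  -- as `B` is contractible, `i` is itself a cone on `A`, so `B` and `K` can swap roles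
  let M : ConeOn A := ⟨B, i, inferInstance, inferInstance⟩
  have swap : collapseBase i K = (pushoutSymmetry i K.ι).hom ≫ collapseCone K.ι M := by
    ext
    · rw [inl_collapseBase, inl_comp_pushoutSymmetry_hom_assoc]
      exact (inr_collapseCone K.ι M).symm
    · rw [inr_collapseBase, inr_comp_pushoutSymmetry_hom_assoc]
      exact (inl_collapseCone K.ι M).symm
  rw [swap]
  infer_instance

variable {H : Type*} [Category* H] (L : C ⥤ H) [L.IsLocalization (weakEquivalences C)]

/-- The connecting map `B / A ⟶ ΣA` of a cofibration `i : A ⟶ B`, computed with the chosen cone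
on `A`; every cone gives the same map, see `map_collapseCone_comp_connecting`. -/
noncomputable def connecting {A B : C} [IsCofibrant A] (i : A ⟶ B) [Cofibration i] :
    L.obj (cokernel i) ⟶ (suspension L).obj (L.obj A) :=
  inv (L.map (collapseCone i (stdCone A).toConeOn)) ≫
    L.map (collapseBase i (stdCone A).toConeOn) ≫ (suspensionIso L (stdCone A).toConeOn).hom

lemma map_collapseCone_comp_cokernelMap_comp_connecting {A B A' B' : C} [IsCofibrant A]
    [IsCofibrant A'] (i : A ⟶ B) (i' : A' ⟶ B') [Cofibration i] [Cofibration i']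
    (f : A ⟶ A') (g : B ⟶ B') (w : i ≫ g = f ≫ i') (K : ConeOn A) :
    L.map (collapseCone i K) ≫ L.map (cokernel.map i i' f g w) ≫ connecting L i' =
      L.map (collapseBase i K) ≫ (suspensionIso L K).hom ≫ (suspension L).map (L.map f) := by
  let K' := (stdCone A').toConeOn
  let r : K.obj ⟶ K'.obj := K.map (stdCone A') f
  have hr : K.ι ≫ r = f ≫ K'.ι := K.ι_map (stdCone A') f
  let m : pushout i K.ι ⟶ pushout i' K'.ι :=
    pushout.desc (g ≫ pushout.inl _ _) (r ≫ pushout.inr _ _)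
      (by rw [reassoc_of% w, reassoc_of% hr, pushout.condition])
  have inl_m : pushout.inl i K.ι ≫ m = g ≫ pushout.inl _ _ := pushout.inl_desc _ _ _
  have inr_m : pushout.inr i K.ι ≫ m = r ≫ pushout.inr _ _ := pushout.inr_desc _ _ _
  have hcone : collapseCone i K ≫ cokernel.map i i' f g w = m ≫ collapseCone i' K' := by
    ext
    · simp [reassoc_of% inl_m, reassoc_of% inl_collapseCone i K, inl_collapseCone i' K']
    · simp [reassoc_of% inr_m, reassoc_of% inr_collapseCone i K, inr_collapseCone i' K']
  have hbase : m ≫ collapseBase i' K' = collapseBase i K ≫ cokernel.map K.ι K'.ι f r hr := by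
    ext
    · simp [reassoc_of% inl_m, reassoc_of% inl_collapseBase i K, inl_collapseBase i' K']
    · simp [reassoc_of% inr_m, reassoc_of% inr_collapseBase i K, inr_collapseBase i' K']
  calc
    _ = L.map m ≫ L.map (collapseCone i' K') ≫ connecting L i' := by
      rw [← L.map_comp_assoc, hcone, L.map_comp_assoc]
    _ = L.map m ≫ L.map (collapseBase i' K') ≫ (suspensionIso L K').hom := by
      simp only [connecting, IsIso.hom_inv_id_assoc, K']
    _ = L.map (collapseBase i K) ≫ L.map (cokernel.map K.ι K'.ι f r hr) ≫
          (suspensionIso L K').hom := by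
      rw [← L.map_comp_assoc, hbase, L.map_comp_assoc]
    _ = _ := by rw [suspensionIso_naturality]

lemma map_collapseCone_comp_connecting {A B : C} [IsCofibrant A] (i : A ⟶ B) [Cofibration i]
    (K : ConeOn A) : L.map (collapseCone i K) ≫ connecting L i =
      L.map (collapseBase i K) ≫ (suspensionIso L K).hom := by
  have h := map_collapseCone_comp_cokernelMap_comp_connecting L i i (𝟙 A) (𝟙 B) (by simp) K
  have hid : cokernel.map i i (𝟙 A) (𝟙 B) (by simp) = 𝟙 _ := by
    ext
    simp
  simpa [hid] using h

lemma connecting_naturality {A B A' B' : C} [IsCofibrant A] [IsCofibrant A']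
    (i : A ⟶ B) (i' : A' ⟶ B') [Cofibration i] [Cofibration i'] (f : A ⟶ A') (g : B ⟶ B')
    (w : i ≫ g = f ≫ i') :
    connecting L i ≫ (suspension L).map (L.map f) =
      L.map (cokernel.map i i' f g w) ≫ connecting L i' := by
  let K := (stdCone A).toConeOn
  rw [← cancel_epi (L.map (collapseCone i K)), map_collapseCone_comp_cokernelMap_comp_connecting,
    reassoc_of% map_collapseCone_comp_connecting L i K]

instance isIso_connecting {A B : C} [IsCofibrant A] (i : A ⟶ B) [Cofibration i]
    [WeakEquivalence (0 : B ⟶ 0)] : IsIso (connecting L i) := by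
  unfold connecting
  infer_instance

end Connecting

section FillIn

variable {C : Type*} [Category* C] [ModelCategory C] [HasZeroMorphisms C] [HasZeroObject C]
  {H : Type*} [Category* H] {L : C ⥤ H} [L.IsLocalization (weakEquivalences C)]

lemma exists_map_cokernel_of_isFibrant {A B A' B' : C} [IsCofibrant A] [IsCofibrant A']
    [IsFibrant A'] [IsFibrant B'] (i : A ⟶ B) (i' : A' ⟶ B') [Cofibration i] [Cofibration i']
    (α : L.obj A ⟶ L.obj A') (β : L.obj B ⟶ L.obj B') (comm : L.map i ≫ β = α ≫ L.map i') :
    ∃ γ : L.obj (cokernel i) ⟶ L.obj (cokernel i'),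
      L.map (cokernel.π i) ≫ γ = β ≫ L.map (cokernel.π i') ∧
      connecting L i ≫ (suspension L).map α = γ ≫ connecting L i' ∧
      (IsIso α → IsIso β → IsIso γ) := by
  obtain ⟨f, g, hfg, rfl, rfl⟩ := exists_strict_square L i i' α β comm
  refine ⟨L.map (cokernel.map i i' f g hfg), ?_, connecting_naturality L i i' f g hfg,
    fun _ _ ↦ ?_⟩
  · simp only [← L.map_comp, cokernel.π_desc]
  · have := weakEquivalence_of_isIso_map L f
    have := weakEquivalence_of_isIso_map L g
    have := weakEquivalence_cokernelMap i i' f g hfg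
    infer_instance

lemma exists_map_cokernel {A B A' B' : C} [IsCofibrant A] [IsCofibrant A']
    (i : A ⟶ B) (i' : A' ⟶ B') [Cofibration i] [Cofibration i']
    (α : L.obj A ⟶ L.obj A') (β : L.obj B ⟶ L.obj B') (comm : L.map i ≫ β = α ≫ L.map i') :
    ∃ γ : L.obj (cokernel i) ⟶ L.obj (cokernel i'),
      L.map (cokernel.π i) ≫ γ = β ≫ L.map (cokernel.π i') ∧
      connecting L i ≫ (suspension L).map α = γ ≫ connecting L i' ∧
      (IsIso α → IsIso β → IsIso γ) := by
  obtain ⟨A'', B'', _, _, _, i'', _, a, b, _, _, hab⟩ := exists_bifibrant_cofibration i'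
  have := weakEquivalence_cokernelMap i' i'' a b hab
  let c := L.map (cokernel.map i' i'' a b hab)
  have hbc : L.map b ≫ L.map (cokernel.π i'') = L.map (cokernel.π i') ≫ c := by
    simp only [c, ← L.map_comp, cokernel.π_desc]
  have hca : connecting L i' ≫ (suspension L).map (L.map a) = c ≫ connecting L i'' :=
    connecting_naturality L i' i'' a b hab
  obtain ⟨γ, hπ, hconn, hγ⟩ := exists_map_cokernel_of_isFibrant i i'' (α ≫ L.map a) (β ≫ L.map b)
    (by rw [reassoc_of% comm, ← L.map_comp, hab, L.map_comp, Category.assoc])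
  refine ⟨γ ≫ inv c, ?_, ?_, fun _ _ ↦ ?_⟩
  · rw [reassoc_of% hπ, reassoc_of% hbc, IsIso.hom_inv_id, Category.comp_id]
  · rw [← cancel_mono ((suspension L).map (L.map a)), Category.assoc, Category.assoc,
      Category.assoc, ← Functor.map_comp, hconn, hca, IsIso.inv_hom_id_assoc]
  · have := hγ inferInstance inferInstance
    infer_instance

lemma IsCofiberTriangle.exists_iso_cokernel {X Y Z : H} {u : X ⟶ Y} {v : Y ⟶ Z}
    {w : Z ⟶ (suspension L).obj X} (h : IsCofiberTriangle L u v w) :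
    ∃ (A B : C) (_ : IsCofibrant A) (i : A ⟶ B) (_ : Cofibration i)
      (eX : L.obj A ≅ X) (eY : L.obj B ≅ Y) (eZ : L.obj (cokernel i) ≅ Z),
      L.map i ≫ eY.hom = eX.hom ≫ u ∧ L.map (cokernel.π i) ≫ eZ.hom = eY.hom ≫ v ∧
      connecting L i ≫ (suspension L).map eX.hom = eZ.hom ≫ w := by
  obtain ⟨A, B, _, i, _, K, eX, eY, eZ, hu, hv, hw⟩ := h
  refine ⟨A, B, inferInstance, i, inferInstance, eX, eY, eZ, hu, hv, ?_⟩
  rw [← cancel_epi (L.map (collapseCone i K)), hw,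
    reassoc_of% map_collapseCone_comp_connecting L i K]

lemma IsCofiberTriangle.exists_map {X Y Z X' Y' Z' : H} {u : X ⟶ Y} {v : Y ⟶ Z}
    {w : Z ⟶ (suspension L).obj X} {u' : X' ⟶ Y'} {v' : Y' ⟶ Z'}
    {w' : Z' ⟶ (suspension L).obj X'} (h : IsCofiberTriangle L u v w)
    (h' : IsCofiberTriangle L u' v' w') (α : X ⟶ X') (β : Y ⟶ Y') (comm : u ≫ β = α ≫ u') :
    ∃ γ : Z ⟶ Z', v ≫ γ = β ≫ v' ∧ w ≫ (suspension L).map α = γ ≫ w' ∧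
      (IsIso α → IsIso β → IsIso γ) := by
  obtain ⟨A, B, _, i, _, eX, eY, eZ, hu, hv, hw⟩ := h.exists_iso_cokernel
  obtain ⟨A', B', _, i', _, eX', eY', eZ', hu', hv', hw'⟩ := h'.exists_iso_cokernel
  have hu'' : u' ≫ eY'.inv = eX'.inv ≫ L.map i' := by
    rw [Iso.comp_inv_eq, Category.assoc, hu', Iso.inv_hom_id_assoc]
  obtain ⟨γ, hπ, hconn, hγ⟩ := exists_map_cokernel i i'
    (eX.hom ≫ α ≫ eX'.inv) (eY.hom ≫ β ≫ eY'.inv)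
    (by simp only [reassoc_of% hu, reassoc_of% comm, hu'', Category.assoc])
  refine ⟨eZ.inv ≫ γ ≫ eZ'.hom, ?_, ?_, fun _ _ ↦ ?_⟩
  · rw [← cancel_epi eY.hom, ← reassoc_of% hv, Iso.hom_inv_id_assoc, reassoc_of% hπ, hv']
    simp
  · rw [← cancel_epi eZ.hom, ← reassoc_of% hw]
    simp only [Category.assoc, Iso.hom_inv_id_assoc]
    rw [← hw', ← reassoc_of% hconn, ← Functor.map_comp, ← Functor.map_comp]
    simp
  · have := hγ inferInstance inferInstance
    infer_instance

end FillIn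

section Zero

variable {C : Type*} [Category* C] [ModelCategory C] [HasZeroMorphisms C] [HasZeroObject C]
  {H : Type*} [Category* H] [HasZeroMorphisms H] {L : C ⥤ H}
  [L.IsLocalization (weakEquivalences C)]

variable (L) in
lemma isZero_suspension {X : H} (hX : IsZero X) : IsZero ((suspension L).obj X) := by
  have := isCofibrant_of_isZero (isZero_zero C)
  have : WeakEquivalence (0 : (0 : C) ⟶ 0) := by
    rw [← id_zero]
    infer_instance
  let K : ConeOn (0 : C) := ⟨0, 𝟙 0, inferInstance, inferInstance⟩
  have hK : IsZero (L.obj K.quot) := isZero_map_of_isZero L (isZero_cokernel_of_epi _)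
  exact hK.of_iso
    ((suspension L).mapIso (hX.iso (isZero_map_of_isZero L (isZero_zero C))) ≪≫
      (suspensionIso L K).symm)

variable (L) in
lemma isZero_iteratedSuspension (k : ℕ) {X : H} (hX : IsZero X) :
    IsZero ((iteratedSuspension L k).obj X) := by
  induction k with
  | zero => exact hX
  | succ k ih => exact isZero_suspension L ih

lemma IsCofiberTriangle.isIso_of_isZero {X Y Z : H} {u : X ⟶ Y} {v : Y ⟶ Z}
    {w : Z ⟶ (suspension L).obj X} (h : IsCofiberTriangle L u v w) (hY : IsZero Y) :
    IsIso w := by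
  obtain ⟨A, B, _, i, _, eX, eY, eZ, -, -, hw⟩ := h.exists_iso_cokernel
  have : IsIso (L.map (0 : B ⟶ 0)) :=
    (hY.of_iso eY).isIso (isZero_map_of_isZero L (isZero_zero C)) _
  have := weakEquivalence_of_isIso_map L (0 : B ⟶ 0)
  exact IsIso.of_isIso_fac_left hw.symm

end Zero

section Totalization

variable {C : Type*} [Category* C] [ModelCategory C] [HasZeroMorphisms C] [HasZeroObject C]
  {H : Type*} [Category* H] [Preadditive H] {L : C ⥤ H}
  [L.IsLocalization (weakEquivalences C)] {K K' : ChainComplex H ℕ}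

lemma Totalization.isIso_proj (S : Totalization L K) (m : ℕ) (hK : ∀ j < m, IsZero (K.X j)) :
    IsIso (S.proj m) := by
  induction m with
  | zero => exact S.isIso_proj_zero
  | succ m ih =>
    have := ih fun j hj ↦ hK j (by lia)
    have hT : IsZero (S.T m) :=
      (isZero_iteratedSuspension L m (hK m (by lia))).of_iso (asIso (S.proj m))
    exact (S.isCofiberTriangle m).isIso_of_isZero hT

lemma Totalization.att_comp_eq_of_mono_proj (S : Totalization L K) (T : Totalization L K')
    (φ : K ⟶ K') (k : ℕ) [Mono (T.proj k)] (a : S.T k ⟶ T.T k)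
    (ha : S.proj k ≫ (iteratedSuspension L k).map (φ.f k) = a ≫ T.proj k) :
    S.att k ≫ a = (iteratedSuspension L k).map (φ.f (k + 1)) ≫ T.att k := by
  rw [← cancel_mono (T.proj k), Category.assoc, ← ha, reassoc_of% S.att_proj k, Category.assoc,
    T.att_proj, ← Functor.map_comp, ← Functor.map_comp, φ.comm]

lemma FilteredMap.exists_of_att_comp_eq (S : Totalization L K) (T : Totalization L K') (φ : K ⟶ K')
    (att_comp_eq : ∀ (k : ℕ) (a : S.T k ⟶ T.T k),
      S.proj k ≫ (iteratedSuspension L k).map (φ.f k) = a ≫ T.proj k →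
      S.att k ≫ a = (iteratedSuspension L k).map (φ.f (k + 1)) ≫ T.att k) :
    ∃ h : FilteredMap S T φ, (∀ k, IsIso (φ.f k)) → ∀ k, IsIso (h.app k) := by
  let P (k : ℕ) : Type _ := { a : S.T k ⟶ T.T k //
    S.proj k ≫ (iteratedSuspension L k).map (φ.f k) = a ≫ T.proj k }
  have exists_next (k : ℕ) (a : P k) : ∃ b : P (k + 1), S.incl k ≫ b.1 = a.1 ≫ T.incl k ∧
      (IsIso ((iteratedSuspension L k).map (φ.f (k + 1))) → IsIso a.1 → IsIso b.1) := by
    obtain ⟨γ, hincl, hproj, hγ⟩ := (S.isCofiberTriangle k).exists_map (T.isCofiberTriangle k)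
      ((iteratedSuspension L k).map (φ.f (k + 1))) a.1 (att_comp_eq k a.1 a.2)
    exact ⟨⟨γ, hproj⟩, hincl, hγ⟩
  choose next incl_next isIso_next using exists_next
  have := S.isIso_proj_zero
  have := T.isIso_proj_zero
  let a₀ : P 0 := ⟨S.proj 0 ≫ (iteratedSuspension L 0).map (φ.f 0) ≫ inv (T.proj 0), by simp⟩
  let a (k : ℕ) : P k := Nat.rec a₀ next k
  refine ⟨⟨fun k ↦ (a k).1, fun k ↦ incl_next k (a k), fun k ↦ (a k).2,
    fun k ↦ att_comp_eq k _ (a k).2⟩, fun hφ k ↦ ?_⟩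
  induction k with
  | zero => exact inferInstanceAs (IsIso (_ ≫ _ ≫ _))
  | succ k ih => exact isIso_next k (a k) inferInstance ih

lemma isIso_grMap_f [HasZeroObject H] (l n : ℕ) (φ : K ⟶ K') (hφ : ∀ k, IsIso (φ.f k)) (k : ℕ) :
    IsIso ((grMap l n φ).f k) := by
  change IsIso (grMapF l n φ k)
  by_cases h : k ≤ n ∧ n < k + l
  · rw [grMapF, dif_pos h]
    infer_instance
  · exact (isZero_grX K h).isIso (isZero_grX K' h) _

end Totalization

end StableTot

theorem mainTheorem6_general {C : Type*} [Category* C] [ModelCategory C] [HasZeroMorphisms C]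
    [HasZeroObject C] {H : Type*} [Category* H] [Preadditive H]
    {L : C ⥤ H} [L.IsLocalization (weakEquivalences C)] {K K' : ChainComplex H ℕ} (n : ℕ)
    (hK : ∀ j, n < j → IsZero (K.X j)) (hK' : ∀ j, j + 1 < n → IsZero (K'.X j))
    (S : Totalization L K) (T : Totalization L K') (φ : K ⟶ K') :
    ∃ h : FilteredMap S T φ, (∀ k, IsIso (φ.f k)) → ∀ k, IsIso (h.app k) := by
  refine FilteredMap.exists_of_att_comp_eq S T φ fun k a ha ↦ ?_
  rcases lt_or_ge k n with hk | hk
  · have := T.isIso_proj k fun j hj ↦ hK' j (by lia)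
    exact S.att_comp_eq_of_mono_proj T φ k a ha
  · exact (isZero_iteratedSuspension L k (hK (k + 1) (by lia))).eq_of_src _ _

theorem mainTheorem6 {C : Type*} [Category* C] [ModelCategory C] [HasZeroMorphisms C]
    [HasZeroObject C] {H : Type*} [Category* H] [Preadditive H] [HasZeroObject H]
    (L : C ⥤ H) [L.IsLocalization (weakEquivalences C)] [(suspension L).IsEquivalence]
    (X Y : SimplicialObject H) (f : X ⟶ Y) (n : ℕ) (hn : 1 ≤ n)
    (S : Totalization L (gr 2 n ((alternatingFaceMapComplex H).obj X)))
    (T : Totalization L (gr 2 n ((alternatingFaceMapComplex H).obj Y))) :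
    ∃ h : FilteredMap S T (grMap 2 n ((alternatingFaceMapComplex H).map f)),
      (∀ m : ℕ, IsIso (f.app (Opposite.op (SimplexCategory.mk m)))) → IsIso h.tot := by
  obtain ⟨h, hh⟩ := mainTheorem6_general n (fun _ _ ↦ isZero_grX _ (by lia))
    (fun _ _ ↦ isZero_grX _ (by lia)) S T (grMap 2 n ((alternatingFaceMapComplex H).map f))
  exact ⟨h, fun hf ↦ hh (isIso_grMap_f 2 n _ hf) n⟩
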